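/- For integers $n_1,\dots,n_m\ge 1$ with $n_m\ge 2$ put $$\overline\zeta(n_1,\dots,n_m)=(2\pi i)^{-w}\sum_{0<k_1<\dots<k_m}\frac1{k_1^{n_1}\cdots k_m^{n_m}},\qquad w=n_1+\dots+n_m$$ ($w$ is the weight, $m$ the depth; the empty index gives $1$). Let $\mathcal Z_{\le w,\le m}\subset\mathbb C$ be the $\mathbb Q$-span of all such numbers of weight $\le w$ and depth $\le m$, and let $$\overline Z_{w,m}(1)=\mathcal Z_{\le w,\le m}\Big/\Big(\mathcal Z_{\le w-1,\le m}+\mathcal Z_{\le w,\le m-1}+\sum \mathcal Z_{\le w_1,\le m_1}\cdot\mathcal Z_{\le w_2,\le m_2}\Big),$$ the last sum being over $w_1+w_2=w$, $m_1+m_2=m$ with $w_1,w_2,m_1,m_2>0$. This is the weight $w$, depth $m$ component of $Z/(Z_{>0,>0})^2$, where $Z$ is the associated graded, for the weight and depth filtrations, of the algebra of normalized multiple zeta values. For a finite commutative group $G$ and $w\ge m\ge1$ let $\mathcal D_{w,m}(G)$ be the $\mathbb Q$-vector space generated by symbols $\{g_1,\dots,g_m\}_{n_1,\dots,n_m}$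 with $g_i\in G$, $n_i\ge1$, $n_1+\dots+n_m=w$, subject to the following relations. They are written in terms of the generating functions $$\{g_0,\dots,g_m|t_0:\dots:t_m\}=\sum_{n_i\ge1}\{g_1,\dots,g_m\}_{n_1,\dots,n_m}\prod_{i=1}^m(t_i-t_0)^{n_i-1},\qquad g_0\cdots g_m=1,$$ and $$\{g_0:\dots:g_m|t_0,\dots,t_m\}=\{g_0^{-1}g_1,\dots,g_m^{-1}g_0|t_0:t_0+t_1:\dots:t_0+\dots+t_m\},\qquad t_0+\dots+t_m=0.$$ 1. Dihedral symmetry: $\{g_0,\dots,g_m|t_0:\dots:t_m\}=\{g_1,\dots,g_m,g_0|t_1:\dots:t_m:t_0\}=(-1)^{m+1}\{g_m,\dots,g_0|t_m:\dots:t_0\}$. 2. Double shuffle: for $k,l\ge1$ with $k+l=m$, $$\sum_\sigma\{g_0:g_{\sigma(1)}:\dots:g_{\sigma(m)}|t_0,t_{\sigma(1)},\dots,t_{\sigma(m)}\}=0$$ and $$\sum_\sigma\{g_0,g_{\sigma(1)},\dots,g_{\sigma(m)}|t_0:t_{\sigma(1)}:\dots:t_{\sigma(m)}\}=0,$$ where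 $\sigma$ runs over all permutations for which $\sigma(1),\dots,\sigma(m)$ is a shuffle of $1,\dots,k$ and $k+1,\dots,m$. 3. Distribution: for $l\in\mathbb Z$ with $|l|$ dividing $|G|$, $$\{g_0^l,\dots,g_m^l|t_0:\dots:t_m\}=\sum\{y_0,\dots,y_m|lt_0:\dots:lt_m\},$$ the sum being over all $(y_0,\dots,y_m)\in G^{m+1}$ with $y_0\cdots y_m=1$ and $y_i^l=g_i^l$ for all $i$. The relation $\{1\}_1=\sum_{y^l=1}\{y\}_1$ is not imposed. Write $\mathcal D_{w,m}(1)$ for $\mathcal D_{w,m}(\mu_1)$, where $\mu_1=\{1\}$. **Theorem.** Let $w\ge2$ be an integer. a) If $w$ is odd, then $\dim_{\mathbb Q}\overline Z_{w,2}(1)=\dim_{\mathbb Q}\mathcal D_{w,2}(1)=0$. b) If $w$ is even, then $\dim_{\mathbb Q}\overline Z_{w,2}(1)\le\dim_{\mathbb Q}\mathcal D_{w,2}(1)=\left[\frac{w-2}6\right]$, where $[x]$ denotes the integer part of $x$. -/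

import Mathlib

/-! ### Multiple zeta values, their weight and depth filtrations, and the reduced bigraded space -/

/-- The multiple zeta value `ζ(n₁, …, n_m) = ∑_{0 < k₁ < ⋯ < k_m} 1 / (k₁ ^ n₁ ⋯ k_m ^ n_m)`
(equal to `1` for `m = 0`).  It is only used for admissible indices, where the series converges. -/
noncomputable def multiZeta {m : ℕ} (n : Fin m → ℕ) : ℝ :=
  ∑' k : {k : Fin m → ℕ // StrictMono k ∧ ∀ i, 0 < k i}, ∏ i, 1 / ((k.1 i : ℝ) ^ n i)

/-- Admissible indices: all `n_i ≥ 1` and the last one is `≥ 2`. -/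
def ZetaAdmissible {m : ℕ} (n : Fin m → ℕ) : Prop :=
  (∀ i, 1 ≤ n i) ∧ ∀ i : Fin m, (i : ℕ) + 1 = m → 2 ≤ n i

/-- The normalized value `(2πi)^{-w} ζ(n₁, …, n_m)`, where `w = n₁ + ⋯ + n_m` is the weight. -/
noncomputable def normalizedZeta {m : ℕ} (n : Fin m → ℕ) : ℂ :=
  ((2 * (Real.pi : ℂ) * Complex.I) ^ (∑ i, n i))⁻¹ * (multiZeta n : ℂ)

/-- The `ℚ`-span of the normalized multiple zeta values of weight `≤ w` and depth `≤ m`. -/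
noncomputable def zetaSpan (w m : ℕ) : Submodule ℚ ℂ :=
  Submodule.span ℚ {z | ∃ (m' : ℕ) (n : Fin m' → ℕ),
    m' ≤ m ∧ ZetaAdmissible n ∧ ∑ i, n i ≤ w ∧ z = normalizedZeta n}

/-- The span of the values of smaller weight (and depth `≤ m`) and of those of smaller depth
(and weight `≤ w`). -/
noncomputable def zetaLower (w m : ℕ) : Submodule ℚ ℂ :=
  (⨆ w' : Fin w, zetaSpan w' m) ⊔ (⨆ m' : Fin m, zetaSpan w m')

/-- The span of the products of two values of positive weights and depths, with total weight `w`
and total depth `m`. -/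
noncomputable def zetaProducts (w m : ℕ) : Submodule ℚ ℂ :=
  ⨆ (w₁ : ℕ) (w₂ : ℕ) (m₁ : ℕ) (m₂ : ℕ)
    (_ : 0 < w₁ ∧ 0 < w₂ ∧ 0 < m₁ ∧ 0 < m₂ ∧ w₁ + w₂ = w ∧ m₁ + m₂ = m),
    zetaSpan w₁ m₁ * zetaSpan w₂ m₂

/-- The weight `w`, depth `m` component of `Z / (Z_{>0,>0})²`, where `Z` is the associated graded,
for the weight and depth filtrations, of the algebra of normalized multiple zeta values. -/
abbrev ReducedZeta (w m : ℕ) : Type :=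
  zetaSpan w m ⧸ (zetaLower w m ⊔ zetaProducts w m).submoduleOf (zetaSpan w m)

/-! ### The components of the dihedral Lie coalgebra of a finite commutative group -/

section Dihedral

variable (R : Type) [CommRing R] (G : Type) [CommGroup G] (w m : ℕ)

/-- The indices `(n₁, …, n_m)` with `n_i ≥ 1` and `n₁ + ⋯ + n_m = w`. -/
def dihedralIndices : Finset (Fin m → ℕ) :=
  (Finset.Nat.antidiagonalTuple m w).filter fun n => ∀ i, 1 ≤ n i

/-- The generating symbols `{g₁, …, g_m}_{n₁, …, n_m}` of weight `w` and depth `m`. -/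
abbrev DihedralGen : Type := (Fin m → G) × dihedralIndices w m

/-- Polynomials in `t₀, …, t_m` with coefficients in the free `R`-module on the symbols
`{g₁, …, g_m}_{n₁, …, n_m}` of weight `w`. -/
abbrev DihedralPoly : Type := DihedralGen G w m →₀ MvPolynomial (Fin (m + 1)) R

variable {R G} {m}

/-- The weight `w` part of the generating function
`{g₀, …, g_m | t₀ : ⋯ : t_m} = ∑ {g₁, …, g_m}_{n₁, …, n_m} ∏ (t_i - t₀) ^ (n_i - 1)`,
for `g₀ ⋯ g_m = 1`. -/
noncomputable def dihedralWord (g : Fin (m + 1) → G)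
    (t : Fin (m + 1) → MvPolynomial (Fin (m + 1)) R) : DihedralPoly R G w m :=
  ∑ n : dihedralIndices w m,
    Finsupp.single (Fin.tail g, n) (∏ i : Fin m, (t i.succ - t 0) ^ (n.1 i - 1))

/-- The homogeneous word `{g₀ : ⋯ : g_m | t₀, …, t_m}` (with `t₀ + ⋯ + t_m = 0`), that is
`{g₀⁻¹g₁, g₁⁻¹g₂, …, g_m⁻¹g₀ | t₀ : t₀ + t₁ : ⋯ : t₀ + ⋯ + t_m}`.
The addition `i + 1` in `Fin (m + 1)` is cyclic. -/
noncomputable def dihedralHomWord (g : Fin (m + 1) → G)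
    (t : Fin (m + 1) → MvPolynomial (Fin (m + 1)) R) : DihedralPoly R G w m :=
  dihedralWord w (fun i => (g i)⁻¹ * g (i + 1)) (fun i => ∑ j ∈ Finset.Iic i, t j)

variable (R) (m) in
/-- The generic variables `t₀, …, t_m` subject to `t₀ + ⋯ + t_m = 0`. -/
noncomputable def zeroSumVars : Fin (m + 1) → MvPolynomial (Fin (m + 1)) R :=
  Fin.cons (-∑ i : Fin m, MvPolynomial.X i.succ) fun i => MvPolynomial.X i.succ

open Classical in
/-- The permutations `σ` such that the word `σ(1) ⋯ σ(m)` is a shuffle of `1 ⋯ k` and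
`k+1 ⋯ m`. -/
noncomputable def shuffles (m k : ℕ) : Finset (Equiv.Perm (Fin m)) :=
  Finset.univ.filter fun σ => ∀ i j : Fin m, i < j →
    ((j : ℕ) < k ∨ k ≤ (i : ℕ)) → σ.symm i < σ.symm j

/-- `(a₀, a_{σ(1)}, …, a_{σ(m)})`. -/
def permTail {α : Type} (σ : Equiv.Perm (Fin m)) (a : Fin (m + 1) → α) : Fin (m + 1) → α :=
  Fin.cons (a 0) fun i => a (σ i).succ

variable (R G) (m) in
/-- The relations among generating functions: each `p` below stands for the relations saying that
all coefficients of `p`, as a polynomial in `t₀, …, t_m`, vanish. -/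
inductive DihedralRel : DihedralPoly R G w m → Prop
  | rotation (g : Fin (m + 1) → G) (hg : ∏ i, g i = 1) :
      DihedralRel (dihedralWord w g MvPolynomial.X
        - dihedralWord w (fun i => g (i + 1)) (fun i => MvPolynomial.X (i + 1)))
  | reflection (g : Fin (m + 1) → G) (hg : ∏ i, g i = 1) :
      DihedralRel (dihedralWord w g MvPolynomial.X
        - (-1 : R) ^ (m + 1) • dihedralWord w (fun i => g i.rev) (fun i => MvPolynomial.X i.rev))
  | shuffleHom (k : ℕ) (hk : 1 ≤ k) (hkm : k < m) (g : Fin (m + 1) → G) :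
      DihedralRel (∑ σ ∈ shuffles m k,
        dihedralHomWord w (permTail σ g) (permTail σ (zeroSumVars R m)))
  | shuffle (k : ℕ) (hk : 1 ≤ k) (hkm : k < m) (g : Fin (m + 1) → G) (hg : ∏ i, g i = 1) :
      DihedralRel (∑ σ ∈ shuffles m k,
        dihedralWord w (permTail σ g) (permTail σ MvPolynomial.X))
  | distribution (l : ℤ) (hl : l.natAbs ∣ Nat.card G) (g : Fin (m + 1) → G)
      (hg : ∏ i, g i = 1) (hex : ¬ (w = 1 ∧ m = 1 ∧ ∀ i, g i ^ l = 1)) :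
      DihedralRel (dihedralWord w (fun i => g i ^ l) MvPolynomial.X
        - ∑ᶠ (y : Fin (m + 1) → G) (_ : ∏ i, y i = 1 ∧ ∀ i, y i ^ l = g i ^ l),
            dihedralWord w y (fun i => (l : MvPolynomial (Fin (m + 1)) R) * MvPolynomial.X i))

variable (R G) (m) in
/-- The weight `w`, depth `m` component of the dihedral Lie coalgebra of the finite commutative
group `G`, with coefficients in `R` (for `R = ℚ`: tensored with `ℚ`). -/
abbrev DihedralCoalgebra : Type :=
  (DihedralGen G w m →₀ R) ⧸ Submodule.span R
    {c | ∃ p : DihedralPoly R G w m, DihedralRel R G w m p ∧ ∃ d : Fin (m + 1) →₀ ℕ,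
      c = p.mapRange (MvPolynomial.coeff d) (MvPolynomial.coeff_zero d)}

end Dihedral

/-! For the trivial group, a linear functional on the depth two symbols of weight `d + 2` is a
binary form `f` of degree `d`. It kills the relations exactly when `f x y = -f y x` and `f x y = -f
(y - x) y` (`mem_dualAnnihilator_iff_isDoubleShuffle`): the other relations follow from these two.
The product of the two reflections is a rotation of order six whose cube is `-1`, so `f (-x) (-y) =
f x y`, and `f = 0` when `d` is odd.

For even `d`, setting `y = 1` turns `f` into a polynomial that is alternating under the group of
order six permuting `0, 1, ∞`. Multiplication by the invariant `x² (x - 1)²` of degree six embeds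
`altPoly d` in `altPoly (d + 6)` as the kernel of the coefficient of `x`, which is a nonzero
functional. The dimension therefore grows by one when `d` grows by six; for even `d ≤ 4` there are
too many forced zeros, so it is `d / 6` (`finrank_altPoly`).

For the inequality, the symbol of index `(i + 1, d - i + 1)` is sent to the class of the double zeta
value with that index. The stuffle and shuffle formulas for `ζ(a) ζ(b)`, read modulo products and
depth one, are the two functional equations. The divergent `ζ(d + 1, 1)` is replaced by `-ζ(1, d +
1)`; the boundary shuffle equation then becomes Euler's sum formula. The resulting map is well
defined and surjective. -/

open Polynomial in
/-- The polynomials of degree at most `d` that change sign under `x ↦ 1 - x` and under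
`p ↦ x ^ d p(1 / x)`. -/
noncomputable def altPoly (d : ℕ) : Submodule ℚ ℚ[X] where
  carrier := {p | p.natDegree ≤ d ∧ p.reflect d = -p ∧ p.comp (1 - X) = -p}
  add_mem' := by
    rintro p q ⟨hp, hp', hp''⟩ ⟨hq, hq', hq''⟩
    refine ⟨natDegree_add_le_of_degree_le hp hq, ?_, ?_⟩
    · rw [reflect_add, hp', hq']; ring
    · rw [add_comp, hp'', hq'']; ring
  zero_mem' := by simp
  smul_mem' := by
    rintro a p ⟨hp, hp', hp''⟩
    refine ⟨(natDegree_smul_le a p).trans hp, ?_, ?_⟩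
    · rw [smul_eq_C_mul, reflect_C_mul, hp']; ring
    · rw [smul_comp, hp'']; simp

/-! ### Alternating polynomials and their dimension. -/

section altPoly

open Polynomial

theorem mem_altPoly {d : ℕ} {p : ℚ[X]} :
    p ∈ altPoly d ↔ p.natDegree ≤ d ∧ p.reflect d = -p ∧ p.comp (1 - X) = -p := Iff.rfl

theorem altPoly_le_degreeLT (d : ℕ) : altPoly d ≤ degreeLT ℚ (d + 1) := fun p hp => by
  rw [mem_degreeLT]
  exact lt_of_le_of_lt degree_le_natDegree (by exact_mod_cast Nat.lt_succ_of_le hp.1)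

instance (d : ℕ) : FiniteDimensional ℚ (altPoly d) :=
  Submodule.finiteDimensional_of_le (altPoly_le_degreeLT d)

theorem eval_one_sub_of_mem_altPoly {d : ℕ} {p : ℚ[X]} (hp : p ∈ altPoly d) (x : ℚ) :
    p.eval (1 - x) = -p.eval x := by
  have := congrArg (eval x) hp.2.2
  simpa using this

theorem eval_one_of_mem_altPoly {d : ℕ} {p : ℚ[X]} (hp : p ∈ altPoly d) : p.eval 1 = 0 := by
  let _ : Invertible (1 : ℚ) := invertibleOne
  have := eval₂_reflect_mul_pow (RingHom.id ℚ) 1 d p hp.1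
  rw [hp.2.1] at this
  simp only [invOf_one, one_pow, mul_one, eval₂_id, eval_neg] at this
  linarith

theorem eval_neg_one_of_mem_altPoly {d : ℕ} (hd : Even d) {p : ℚ[X]} (hp : p ∈ altPoly d) :
    p.eval (-1) = 0 := by
  let _ : Invertible (1 : ℚ) := invertibleOne
  let _ : Invertible (-1 : ℚ) := invertibleNeg 1
  have := eval₂_reflect_mul_pow (RingHom.id ℚ) (-1) d p hp.1
  rw [hp.2.1] at this
  simp only [invOf_neg, invOf_one, hd.neg_one_pow, mul_one, eval₂_id, eval_neg] at this
  linarith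

theorem eval_zero_of_mem_altPoly {d : ℕ} {p : ℚ[X]} (hp : p ∈ altPoly d) : p.eval 0 = 0 := by
  have := eval_one_sub_of_mem_altPoly hp 0
  rw [sub_zero, eval_one_of_mem_altPoly hp] at this
  linarith

/-- The sign change forces zeros at fixed points: `1` and, as `d` is even, `-1` for inversion, `1 /
2` for `x ↦ 1 - x`. Their images `0` and `2` are zeros too, making five in degree at most four. -/
theorem altPoly_eq_bot {d : ℕ} (hd : Even d) (hd4 : d ≤ 4) : altPoly d = ⊥ := by
  rw [eq_bot_iff]
  intro p hp
  have h1 := eval_one_of_mem_altPoly hp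
  have h0 := eval_zero_of_mem_altPoly hp
  have hn := eval_neg_one_of_mem_altPoly hd hp
  have h2 := eval_one_sub_of_mem_altPoly hp (-1)
  have hh := eval_one_sub_of_mem_altPoly hp (1 / 2)
  rw [hn] at h2
  refine eq_zero_of_natDegree_lt_card_of_eval_eq_zero' p {0, 1, -1, 2, 1 / 2} ?_ ?_
  · norm_num at h2 hh ⊢
    refine ⟨h0, h1, hn, h2, by linarith⟩
  · exact lt_of_le_of_lt (hp.1.trans hd4) (by decide +kernel)

/-- The square of `x (x - 1)`, the degree six invariant vanishing at `0`, `1` and `∞`. -/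
noncomputable def altMul : ℚ[X] := X ^ 2 * (X - 1) ^ 2

theorem altMul_ne_zero : altMul ≠ 0 :=
  mul_ne_zero (pow_ne_zero _ X_ne_zero) (pow_ne_zero _ (X_sub_C_ne_zero (1 : ℚ)))

theorem natDegree_altMul : altMul.natDegree = 4 := by
  unfold altMul; compute_degree!

theorem reflect_altMul : altMul.reflect 6 = altMul := by
  have : altMul = C 1 * X ^ 4 + C (-2) * X ^ 3 + C 1 * X ^ 2 := by
    unfold altMul; simp only [map_neg, map_ofNat, map_one]; ring
  rw [this, reflect_add, reflect_add, reflect_C_mul_X_pow, reflect_C_mul_X_pow,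
    reflect_C_mul_X_pow, revAt_le (by norm_num), revAt_le (by norm_num), revAt_le (by norm_num)]
  ring

theorem altMul_comp : altMul.comp (1 - X) = altMul := by
  simp only [altMul, mul_comp, pow_comp, X_comp, sub_comp, one_comp]; ring

theorem altMul_mul_mem_iff {d : ℕ} {p : ℚ[X]} (hp : p.natDegree ≤ d) :
    altMul * p ∈ altPoly (d + 6) ↔ p ∈ altPoly d := by
  have h0 := altMul_ne_zero
  rw [mem_altPoly, mem_altPoly, add_comm d 6,
    reflect_mul _ _ (natDegree_altMul.trans_le (by norm_num)) hp, reflect_altMul, mul_comp,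
    altMul_comp, ← mul_neg, mul_right_inj' h0, mul_right_inj' h0]
  have : (altMul * p).natDegree ≤ 6 + d :=
    natDegree_mul_le.trans (by rw [natDegree_altMul]; omega)
  tauto

/-- An alternating polynomial already vanishes at `0`, so `h1` makes this zero double. The
symmetries carry it to double zeros at `1` and `∞`, hence divisibility by the invariant form of
degree six. -/
theorem exists_altMul_mul {d : ℕ} {p : ℚ[X]} (hp : p ∈ altPoly (d + 6)) (h1 : p.coeff 1 = 0) :
    ∃ r ∈ altPoly d, p = altMul * r := by
  have h0 : p.coeff 0 = 0 := by
    rw [coeff_zero_eq_eval_zero]; exact eval_zero_of_mem_altPoly hp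
  have hX : X ^ 2 ∣ p := by
    rw [X_pow_dvd_iff]; intro i hi; interval_cases i <;> assumption
  have hX1 : (X - 1) ^ 2 ∣ p := by
    obtain ⟨s, hs⟩ := hX
    refine ⟨-s.comp (1 - X), ?_⟩
    have := hp.2.2
    rw [← neg_eq_iff_eq_neg] at this
    rw [← this]
    nth_rewrite 1 [hs]
    rw [mul_comp, pow_comp, X_comp]; ring
  have hco : IsCoprime ((X : ℚ[X]) ^ 2) ((X - 1) ^ 2) :=
    IsCoprime.pow ⟨1, -1, by ring⟩
  obtain ⟨r, hr⟩ := hco.mul_dvd hX hX1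
  change p = altMul * r at hr
  -- The double zero at `∞`: reflection carries the two lowest coefficients to the two highest.
  have hcoef : ∀ i ≤ 1, p.coeff (d + 6 - i) = 0 := fun i hi => by
    have h := congrArg (fun q => coeff q i) hp.2.1
    simp only [coeff_reflect, coeff_neg] at h
    rw [revAt_le (by omega)] at h
    rw [h]; interval_cases i <;> simp [h0, h1]
  have hdeg : p.natDegree ≤ d + 4 := by
    rw [natDegree_le_iff_coeff_eq_zero]
    intro N hN
    rcases Nat.lt_or_ge (d + 6) N with h | h
    · exact coeff_eq_zero_of_natDegree_lt (hp.1.trans_lt h)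
    · have := hcoef (d + 6 - N) (by omega)
      rwa [show d + 6 - (d + 6 - N) = N by omega] at this
  have hrd : r.natDegree ≤ d := by
    by_cases hr0 : r = 0
    · simp [hr0]
    · rw [hr, natDegree_mul altMul_ne_zero hr0, natDegree_altMul] at hdeg
      omega
  exact ⟨r, (altMul_mul_mem_iff hrd).1 (hr ▸ hp), hr⟩

theorem exists_mem_altPoly_coeff_one_ne_zero (k : ℕ) :
    ∃ p ∈ altPoly (2 * k + 6), p.coeff 1 ≠ 0 := by
  -- `P = x (x - 1) (x + 1) (x - 2) (2x - 1)` has just the forced zeros, including a simple one at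
  -- `∞` as a form of degree six. `R = x² - x + 1` is invariant with `R(0) = 1`, so powers of it
  -- raise the degree without affecting the coefficient of `x`.
  set P : ℚ[X] := C 2 * X ^ 5 + C (-5) * X ^ 4 + C 5 * X ^ 2 + C (-2) * X ^ 1 with hP
  set R : ℚ[X] := C 1 * X ^ 2 + C (-1) * X ^ 1 + C 1 * X ^ 0 with hR
  have hPdeg : P.natDegree ≤ 6 := by rw [hP]; compute_degree!
  have hRdeg : R.natDegree ≤ 2 := by rw [hR]; compute_degree!
  have hRrefl : R.reflect 2 = R := by
    rw [hR, reflect_add, reflect_add, reflect_C_mul_X_pow, reflect_C_mul_X_pow,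
      reflect_C_mul_X_pow, revAt_le (by norm_num), revAt_le (by norm_num), revAt_le (by norm_num)]
    ring
  have hPrefl : P.reflect 6 = -P := by
    rw [hP, reflect_add, reflect_add, reflect_add, reflect_C_mul_X_pow, reflect_C_mul_X_pow,
      reflect_C_mul_X_pow, reflect_C_mul_X_pow, revAt_le (by norm_num), revAt_le (by norm_num),
      revAt_le (by norm_num), revAt_le (by norm_num)]
    simp only [map_neg]
    ring
  have hRcomp : R.comp (1 - X) = R := by
    rw [hR]
    simp only [add_comp, mul_comp, C_comp, pow_comp, X_comp]
    simp only [map_neg, map_one]; ring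
  have hPcomp : P.comp (1 - X) = -P := by
    rw [hP]
    simp only [add_comp, mul_comp, C_comp, pow_comp, X_comp]
    simp only [map_neg, map_ofNat]; ring
  have hpow : (R ^ k).natDegree ≤ 2 * k ∧ (R ^ k).reflect (2 * k) = R ^ k := by
    induction k with
    | zero => simp
    | succ k ih =>
      refine ⟨natDegree_pow_le.trans (by nlinarith), ?_⟩
      rw [pow_succ, mul_add, mul_one, reflect_mul _ _ ih.1 hRdeg, ih.2, hRrefl]
  refine ⟨R ^ k * P, ⟨natDegree_mul_le.trans (add_le_add hpow.1 hPdeg), ?_, ?_⟩, ?_⟩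
  · rw [reflect_mul _ _ hpow.1 hPdeg, hpow.2, hPrefl]; ring
  · rw [mul_comp, pow_comp, hRcomp, hPcomp]; ring
  · have hX : P = (C 2 * X ^ 4 + C (-5) * X ^ 3 + C 5 * X ^ 1 + C (-2)) * X := by rw [hP]; ring
    rw [hX, ← mul_assoc, coeff_mul_X, coeff_zero_eq_eval_zero, hR]
    simp

/-- Rank-nullity for the exact sequence `0 → altPoly d → altPoly (d + 6) → ℚ → 0`, given by
multiplication by `altMul` and the coefficient of `x`. -/
theorem finrank_altPoly_add_six {d : ℕ} (hd : Even d) :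
    Module.finrank ℚ (altPoly (d + 6)) = Module.finrank ℚ (altPoly d) + 1 := by
  obtain ⟨k, rfl⟩ := hd.exists_two_nsmul
  rw [smul_eq_mul]
  let ev : altPoly (2 * k + 6) →ₗ[ℚ] ℚ := (lcoeff ℚ 1).comp (altPoly (2 * k + 6)).subtype
  let mu : altPoly (2 * k) →ₗ[ℚ] altPoly (2 * k + 6) :=
    ((LinearMap.mulLeft ℚ altMul).comp (altPoly (2 * k)).subtype).codRestrict _
      fun p => (altMul_mul_mem_iff p.2.1).2 p.2
  have hmu : Function.Injective mu := fun p q h => by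
    have : altMul * p.1 = altMul * q.1 := congrArg Subtype.val h
    exact Subtype.ext (mul_left_cancel₀ altMul_ne_zero this)
  have hev : LinearMap.range ev = ⊤ := by
    obtain ⟨p, hp, hp1⟩ := exists_mem_altPoly_coeff_one_ne_zero k
    rw [LinearMap.range_eq_top]
    exact LinearMap.surjective (f := ev) (fun h => hp1 (LinearMap.congr_fun h ⟨p, hp⟩))
  have hker : LinearMap.ker ev = LinearMap.range mu := by
    ext p
    constructor
    · intro hp
      obtain ⟨r, hr, hpr⟩ := exists_altMul_mul p.2 hp
      exact ⟨⟨r, hr⟩, Subtype.ext hpr.symm⟩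
    · rintro ⟨r, rfl⟩
      change (altMul * r.1).coeff 1 = 0
      rw [show altMul * r.1 = (X - 1) ^ 2 * r.1 * X ^ 2 by unfold altMul; ring,
        coeff_mul_X_pow']
      simp
  have := LinearMap.finrank_range_add_finrank_ker ev
  rw [hev, hker, finrank_top, Module.finrank_self, LinearMap.finrank_range_of_inj hmu] at this
  omega

theorem finrank_altPoly {d : ℕ} (hd : Even d) : Module.finrank ℚ (altPoly d) = d / 6 := by
  induction d using Nat.strong_induction_on with
  | _ d ih =>
    rcases Nat.lt_or_ge d 6 with h | h
    · have h4 : d ≤ 4 := by rcases hd with ⟨k, rfl⟩; omega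
      rw [altPoly_eq_bot hd h4, finrank_bot]; omega
    · obtain ⟨e, rfl⟩ := Nat.exists_eq_add_of_le' h
      have he : Even e := by rcases hd with ⟨k, hk⟩; exact ⟨k - 3, by omega⟩
      rw [finrank_altPoly_add_six he, ih e (by omega) he]; omega

end altPoly

/-! ### Functionals on the depth two symbols and their functional equations. -/

section DepthTwo

open MvPolynomial

/-- The pairing of a functional on the symbols with a generating function. -/
noncomputable def dihedralPairing {G : Type} {w m : ℕ}
    (φ : Module.Dual ℚ (DihedralGen G w m →₀ ℚ)) :
    DihedralPoly ℚ G w m →ₗ[ℚ] MvPolynomial (Fin (m + 1)) ℚ :=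
  Finsupp.lsum ℚ fun n => φ (Finsupp.single n 1) • LinearMap.id

theorem dihedralPairing_single {G : Type} {w m : ℕ}
    (φ : Module.Dual ℚ (DihedralGen G w m →₀ ℚ)) (n : DihedralGen G w m)
    (q : MvPolynomial (Fin (m + 1)) ℚ) :
    dihedralPairing φ (Finsupp.single n q) = φ (Finsupp.single n 1) • q := by
  simp [dihedralPairing]

theorem coeff_dihedralPairing {G : Type} {w m : ℕ}
    (φ : Module.Dual ℚ (DihedralGen G w m →₀ ℚ)) (p : DihedralPoly ℚ G w m)
    (e : Fin (m + 1) →₀ ℕ) :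
    coeff e (dihedralPairing φ p) = φ (p.mapRange (coeff e) (coeff_zero e)) := by
  induction p using Finsupp.induction_linear with
  | zero => simp
  | add p q hp hq =>
    rw [map_add, coeff_add, hp, hq, ← map_add, Finsupp.mapRange_add (fun _ _ => coeff_add _ _ _)]
  | single n q =>
    rw [dihedralPairing_single, Finsupp.mapRange_single, coeff_smul, smul_eq_mul, mul_comm,
      ← smul_eq_mul, ← map_smul, Finsupp.smul_single, smul_eq_mul, mul_one]

/-- The relations of `DihedralCoalgebra`. -/
noncomputable abbrev dihedralRelations (G : Type) [CommGroup G] (w m : ℕ) :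
    Submodule ℚ (DihedralGen G w m →₀ ℚ) :=
  Submodule.span ℚ
    {c | ∃ p : DihedralPoly ℚ G w m, DihedralRel ℚ G w m p ∧ ∃ d : Fin (m + 1) →₀ ℕ,
      c = p.mapRange (MvPolynomial.coeff d) (MvPolynomial.coeff_zero d)}

/-- The relations are the coefficients of generating functions, and a polynomial over `ℚ` vanishes
once all its values do; relations thus become functional equations. -/
theorem mem_dualAnnihilator_dihedralRelations {G : Type} [CommGroup G] {w m : ℕ}
    {φ : Module.Dual ℚ (DihedralGen G w m →₀ ℚ)} :
    φ ∈ (dihedralRelations G w m).dualAnnihilator ↔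
      ∀ p, DihedralRel ℚ G w m p → ∀ τ : Fin (m + 1) → ℚ, eval τ (dihedralPairing φ p) = 0 := by
  rw [Submodule.mem_dualAnnihilator]
  constructor
  · intro h p hp τ
    have : dihedralPairing φ p = 0 := by
      ext e
      rw [coeff_dihedralPairing, coeff_zero]
      exact h _ (Submodule.subset_span ⟨p, hp, e, rfl⟩)
    rw [this, map_zero]
  · intro h c hc
    have : dihedralRelations G w m ≤ LinearMap.ker φ := by
      refine Submodule.span_le.2 ?_
      rintro _ ⟨p, hp, e, rfl⟩
      have hz : dihedralPairing φ p = 0 := MvPolynomial.funext fun τ => by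
        rw [h p hp τ, map_zero]
      change φ _ = 0
      rw [← coeff_dihedralPairing, hz, coeff_zero]
    exact this hc

/-- The indices `(i + 1, d - i + 1)` of weight `d + 2` and depth `2`. -/
def depthTwoIndex (d : ℕ) : Fin (d + 1) ≃ dihedralIndices (d + 2) 2 where
  toFun i := ⟨![i + 1, d - i + 1], by
    have := i.2
    simp only [dihedralIndices, Finset.mem_filter, Finset.Nat.mem_antidiagonalTuple,
      Fin.sum_univ_two, Fin.forall_fin_two, Matrix.cons_val_zero, Matrix.cons_val_one]
    omega⟩
  invFun n := ⟨n.1 0 - 1, by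
    have := n.2
    simp only [dihedralIndices, Finset.mem_filter, Finset.Nat.mem_antidiagonalTuple,
      Fin.sum_univ_two, Fin.forall_fin_two] at this
    omega⟩
  left_inv i := by simp
  right_inv n := by
    have := n.2
    simp only [dihedralIndices, Finset.mem_filter, Finset.Nat.mem_antidiagonalTuple,
      Fin.sum_univ_two, Fin.forall_fin_two] at this
    refine Subtype.ext (funext fun j => ?_)
    fin_cases j
    · simp only [Fin.zero_eta, Matrix.cons_val_zero]; omega
    · simp only [Fin.mk_one, Matrix.cons_val_one]
      simp only [Matrix.cons_val_fin_one]; omega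

/-- The binary form `∑ c_i x ^ i y ^ (d - i)`. -/
def binaryForm {d : ℕ} (c : Fin (d + 1) → ℚ) (x y : ℚ) : ℚ :=
  ∑ i, c i * (x ^ (i : ℕ) * y ^ (d - i : ℕ))

/-- The values of a functional on the symbols of depth two. -/
noncomputable def depthTwoCoeff {G : Type} [CommGroup G] {d : ℕ}
    (φ : Module.Dual ℚ (DihedralGen G (d + 2) 2 →₀ ℚ)) (i : Fin (d + 1)) : ℚ :=
  φ (Finsupp.single (1, depthTwoIndex d i) 1)

theorem eval_dihedralPairing_dihedralWord {G : Type} [CommGroup G] [Subsingleton G] {d : ℕ}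
    (φ : Module.Dual ℚ (DihedralGen G (d + 2) 2 →₀ ℚ)) (g : Fin 3 → G)
    (t : Fin 3 → MvPolynomial (Fin 3) ℚ) (τ : Fin 3 → ℚ) :
    eval τ (dihedralPairing φ (dihedralWord (d + 2) g t)) =
      binaryForm (depthTwoCoeff φ) (eval τ (t 1) - eval τ (t 0))
        (eval τ (t 2) - eval τ (t 0)) := by
  rw [dihedralWord, map_sum, map_sum, ← (depthTwoIndex d).sum_comp, binaryForm]
  refine Finset.sum_congr rfl fun i _ => ?_
  rw [dihedralPairing_single, smul_eval, Subsingleton.elim (Fin.tail g) 1, depthTwoCoeff]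
  simp [depthTwoIndex, Fin.prod_univ_two]

theorem shuffles_two_one : shuffles 2 1 = {1, Equiv.swap 0 1} := by
  have h : (Finset.univ : Finset (Equiv.Perm (Fin 2))) = {1, Equiv.swap 0 1} := by decide
  rw [← h, shuffles, Finset.filter_eq_self]
  intro σ _ i j hij hk
  have := i.2; have := j.2
  have : (i : ℕ) < j := hij
  omega

theorem sum_shuffles_two_one {M : Type} [AddCommMonoid M] (f : Equiv.Perm (Fin 2) → M) :
    ∑ σ ∈ shuffles 2 1, f σ = f 1 + f (Equiv.swap 0 1) := by
  rw [shuffles_two_one, Finset.sum_pair (by decide)]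

theorem eval_shuffle {G : Type} [CommGroup G] [Subsingleton G] {d : ℕ}
    (φ : Module.Dual ℚ (DihedralGen G (d + 2) 2 →₀ ℚ)) (g : Fin 3 → G) (τ : Fin 3 → ℚ) :
    eval τ (dihedralPairing φ
      (∑ σ ∈ shuffles 2 1, dihedralWord (d + 2) (permTail σ g) (permTail σ X))) =
      binaryForm (depthTwoCoeff φ) (τ 1 - τ 0) (τ 2 - τ 0) +
        binaryForm (depthTwoCoeff φ) (τ 2 - τ 0) (τ 1 - τ 0) := by
  rw [sum_shuffles_two_one, map_add, map_add, eval_dihedralPairing_dihedralWord,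
    eval_dihedralPairing_dihedralWord]
  have h1 : ∀ σ : Equiv.Perm (Fin 2), permTail σ (X : Fin 3 → MvPolynomial (Fin 3) ℚ) 1 =
    X (σ 0).succ := fun σ => rfl
  have h2 : ∀ σ : Equiv.Perm (Fin 2), permTail σ (X : Fin 3 → MvPolynomial (Fin 3) ℚ) 2 =
    X (σ 1).succ := fun σ => rfl
  have h0 : ∀ σ : Equiv.Perm (Fin 2), permTail σ (X : Fin 3 → MvPolynomial (Fin 3) ℚ) 0 =
    X 0 := fun σ => rfl
  simp [h0, h1, h2]

theorem eval_shuffleHom {G : Type} [CommGroup G] [Subsingleton G] {d : ℕ}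
    (φ : Module.Dual ℚ (DihedralGen G (d + 2) 2 →₀ ℚ)) (g : Fin 3 → G) (τ : Fin 3 → ℚ) :
    eval τ (dihedralPairing φ (∑ σ ∈ shuffles 2 1,
      dihedralHomWord (d + 2) (permTail σ g) (permTail σ (zeroSumVars ℚ 2)))) =
      binaryForm (depthTwoCoeff φ) (τ 1) (τ 1 + τ 2) +
        binaryForm (depthTwoCoeff φ) (τ 2) (τ 1 + τ 2) := by
  rw [sum_shuffles_two_one, map_add, map_add, dihedralHomWord, dihedralHomWord,
    eval_dihedralPairing_dihedralWord, eval_dihedralPairing_dihedralWord]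
  have h0 : ∀ σ : Equiv.Perm (Fin 2), permTail σ (zeroSumVars ℚ 2) 0 =
    -∑ i : Fin 2, X i.succ := fun σ => rfl
  have h1 : ∀ σ : Equiv.Perm (Fin 2), permTail σ (zeroSumVars ℚ 2) 1 = X (σ 0).succ :=
    fun σ => rfl
  have h2 : ∀ σ : Equiv.Perm (Fin 2), permTail σ (zeroSumVars ℚ 2) 2 = X (σ 1).succ :=
    fun σ => rfl
  have i0 : Finset.Iic (0 : Fin 3) = {0} := by decide
  have i1 : Finset.Iic (1 : Fin 3) = {0, 1} := by decide
  have i2 : Finset.Iic (2 : Fin 3) = {0, 1, 2} := by decide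
  simp [i0, i1, i2, h0, h1, h2, add_comm]

/-- The functional equations of the double shuffle relations in depth two. -/
def IsDoubleShuffle (f : ℚ → ℚ → ℚ) : Prop :=
  (∀ x y, f x y = -f y x) ∧ ∀ x y, f x y = -f (y - x) y

/-- Two reflections compose to a rotation of order six and their signs cancel; its cube `(x, y) ↦
(-x, -y)` gives the next lemma. -/
theorem IsDoubleShuffle.rotate {f : ℚ → ℚ → ℚ} (h : IsDoubleShuffle f) (x y : ℚ) :
    f x y = f y (y - x) := by
  rw [h.2 x y, h.1, neg_neg]

theorem IsDoubleShuffle.neg_neg {f : ℚ → ℚ → ℚ} (h : IsDoubleShuffle f) (x y : ℚ) :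
    f (-x) (-y) = f x y := by
  rw [h.rotate x y, h.rotate y, h.rotate (y - x)]
  congr 1 <;> ring

theorem mem_dualAnnihilator_iff_isDoubleShuffle {G : Type} [CommGroup G] [Subsingleton G] {d : ℕ}
    {φ : Module.Dual ℚ (DihedralGen G (d + 2) 2 →₀ ℚ)} :
    φ ∈ (dihedralRelations G (d + 2) 2).dualAnnihilator ↔
      IsDoubleShuffle (binaryForm (depthTwoCoeff φ)) := by
  rw [mem_dualAnnihilator_dihedralRelations]
  constructor
  · intro h
    constructor
    · intro x y
      have := h _ (.shuffle 1 le_rfl one_lt_two 1 (by simp)) ![0, x, y]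
      rw [eval_shuffle] at this
      simp only [Matrix.cons_val, sub_zero] at this
      linarith
    · intro x y
      have := h _ (.shuffleHom 1 le_rfl one_lt_two 1) ![0, x, y - x]
      rw [eval_shuffleHom] at this
      simp only [Matrix.cons_val, add_sub_cancel] at this
      linarith
  · intro h p hp τ
    cases hp with
    | rotation g hg =>
      rw [map_sub, map_sub, eval_dihedralPairing_dihedralWord, eval_dihedralPairing_dihedralWord]
      simp only [eval_X, show (2 : Fin 3) + 1 = 0 from rfl, show (1 : Fin 3) + 1 = 2 from rfl,
        zero_add]
      rw [h.rotate (τ 1 - τ 0), h.rotate (τ 2 - τ 0), sub_eq_zero]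
      congr 1 <;> ring
    | reflection g hg =>
      rw [map_sub, map_sub, map_smul, smul_eval, eval_dihedralPairing_dihedralWord,
        eval_dihedralPairing_dihedralWord]
      simp only [eval_X, show (2 : Fin 3).rev = 0 from rfl, show (1 : Fin 3).rev = 1 from rfl,
        show (0 : Fin 3).rev = 2 from rfl]
      rw [h.2 (τ 1 - τ 0), ← h.neg_neg (τ 1 - τ 2)]
      norm_num
    | shuffleHom k hk hkm g =>
      obtain rfl : k = 1 := by omega
      rw [eval_shuffleHom, h.2 (τ 1)]
      simp
    | shuffle k hk hkm g hg =>
      obtain rfl : k = 1 := by omega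
      rw [eval_shuffle, h.1 (τ 1 - τ 0)]
      simp
    -- In the trivial group only `l = 1` and `l = -1` occur, with a single `y`; the second case is
    -- evenness of the form.
    | distribution l hl g hg hex =>
      have hy : ∀ y : Fin 3 → G, (∏ i, y i = 1 ∧ ∀ i, y i ^ l = g i ^ l) ↔ True :=
        fun y => iff_true_intro ⟨Subsingleton.elim _ _, fun i => Subsingleton.elim _ _⟩
      have : Unique G := ⟨⟨1⟩, fun _ => Subsingleton.elim _ _⟩
      simp only [hy, finsum_true]
      rw [finsum_unique, map_sub, map_sub, eval_dihedralPairing_dihedralWord,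
        eval_dihedralPairing_dihedralWord]
      rw [Nat.card_unique, Nat.dvd_one, Int.natAbs_eq_iff] at hl
      rcases hl with rfl | rfl
      · simp
      · rw [sub_eq_zero, ← h.neg_neg]
        simp [sub_eq_add_neg, add_comm]

end DepthTwo

/-! ### Dimension of the depth two component of the coalgebra. -/

section Dimension

open Polynomial

theorem IsDoubleShuffle.eq_zero_of_odd {d : ℕ} (hd : Odd d) {c : Fin (d + 1) → ℚ}
    (h : IsDoubleShuffle (binaryForm c)) (x y : ℚ) : binaryForm c x y = 0 := by
  have h1 := h.neg_neg x y
  have h2 : binaryForm c (-x) (-y) = -binaryForm c x y := by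
    rw [binaryForm, binaryForm, ← Finset.sum_neg_distrib]
    refine Finset.sum_congr rfl fun i _ => ?_
    have hi : (i : ℕ) + (d - i) = d := by have := i.2; omega
    rw [neg_pow x, neg_pow y, mul_mul_mul_comm, ← pow_add, hi, hd.neg_one_pow]
    ring
  linarith

/-- The polynomial `∑ c_i x ^ i`. -/
noncomputable def polyOfCoeff {d : ℕ} (c : Fin (d + 1) → ℚ) : ℚ[X] :=
  ((degreeLTEquiv ℚ (d + 1)).symm c : ℚ[X])

theorem coeff_polyOfCoeff {d : ℕ} (c : Fin (d + 1) → ℚ) (i : Fin (d + 1)) :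
    (polyOfCoeff c).coeff i = c i :=
  congrFun ((degreeLTEquiv ℚ (d + 1)).apply_symm_apply c) i

theorem coeff_polyOfCoeff_of_lt {d : ℕ} (c : Fin (d + 1) → ℚ) {i : ℕ} (hi : d < i) :
    (polyOfCoeff c).coeff i = 0 := by
  have h : degree (polyOfCoeff c) < (d + 1 : ℕ) :=
    mem_degreeLT.1 ((degreeLTEquiv ℚ (d + 1)).symm c).2
  exact coeff_eq_zero_of_degree_lt (h.trans_le (by exact_mod_cast hi))

theorem natDegree_polyOfCoeff_le {d : ℕ} (c : Fin (d + 1) → ℚ) :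
    (polyOfCoeff c).natDegree ≤ d :=
  natDegree_le_iff_coeff_eq_zero.2 fun _ h => coeff_polyOfCoeff_of_lt c h

theorem eval_polyOfCoeff {d : ℕ} (c : Fin (d + 1) → ℚ) (x : ℚ) :
    (polyOfCoeff c).eval x = binaryForm c x 1 := by
  rw [eval_eq_sum_range' (Nat.lt_succ_of_le (natDegree_polyOfCoeff_le c)), Finset.sum_range,
    binaryForm]
  exact Finset.sum_congr rfl fun i _ => by rw [coeff_polyOfCoeff, one_pow, mul_one]

theorem reflect_polyOfCoeff {d : ℕ} (c : Fin (d + 1) → ℚ) :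
    (polyOfCoeff c).reflect d = polyOfCoeff (c ∘ Fin.rev) := by
  ext i
  rw [coeff_reflect]
  rcases Nat.lt_or_ge d i with h | h
  · rw [revAt_eq_self_of_lt h, coeff_polyOfCoeff_of_lt _ h, coeff_polyOfCoeff_of_lt _ h]
  · obtain ⟨j, rfl⟩ : ∃ j : Fin (d + 1), (j : ℕ) = i := ⟨⟨i, by omega⟩, rfl⟩
    have : revAt d j = (j.rev : Fin (d + 1)) := by rw [revAt_le h, Fin.val_rev]; omega
    rw [this, coeff_polyOfCoeff, coeff_polyOfCoeff]; rfl

theorem binaryForm_comp_rev {d : ℕ} (c : Fin (d + 1) → ℚ) (x y : ℚ) :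
    binaryForm (c ∘ Fin.rev) x y = binaryForm c y x := by
  rw [binaryForm, binaryForm, ← Equiv.sum_comp Fin.revPerm]
  refine Finset.sum_congr rfl fun i _ => ?_
  have := i.2
  simp only [Fin.revPerm_apply, Function.comp_apply, Fin.rev_rev, Fin.val_rev]
  rw [show d - (d + 1 - (i + 1)) = (i : ℕ) by omega, show d + 1 - ((i : ℕ) + 1) = d - i by omega]
  ring

theorem binaryForm_eq_pow_mul {d : ℕ} (c : Fin (d + 1) → ℚ) (x : ℚ) {y : ℚ} (hy : y ≠ 0) :
    binaryForm c x y = y ^ d * binaryForm c (x / y) 1 := by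
  rw [binaryForm, binaryForm, Finset.mul_sum]
  refine Finset.sum_congr rfl fun i _ => ?_
  have hi : y ^ d = y ^ (i : ℕ) * y ^ (d - i) := by
    rw [← pow_add]; congr 1; have := i.2; omega
  rw [hi, div_pow, one_pow]
  field_simp

theorem binaryForm_zero_right {d : ℕ} (c : Fin (d + 1) → ℚ) (x : ℚ) :
    binaryForm c x 0 = c (Fin.last d) * x ^ d := by
  rw [binaryForm, Finset.sum_eq_single (Fin.last d)]
  · simp
  · intro i _ hi
    have : d - (i : ℕ) ≠ 0 := by
      have := Fin.val_lt_last hi; omega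
    rw [zero_pow this]; ring
  · simp

theorem isDoubleShuffle_binaryForm_iff {d : ℕ} (c : Fin (d + 1) → ℚ) :
    IsDoubleShuffle (binaryForm c) ↔ polyOfCoeff c ∈ altPoly d := by
  constructor
  · intro h
    refine ⟨natDegree_polyOfCoeff_le c, ?_, ?_⟩
    · refine Polynomial.funext fun x => ?_
      rw [reflect_polyOfCoeff, eval_neg, eval_polyOfCoeff, eval_polyOfCoeff, binaryForm_comp_rev]
      exact h.1 _ _
    · refine Polynomial.funext fun x => ?_
      rw [eval_comp, eval_neg, eval_polyOfCoeff, eval_polyOfCoeff, h.2 x, neg_neg]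
      simp
  · intro h
    have hrev : c ∘ Fin.rev = -c := by
      funext i
      have := congrArg (fun p => coeff p i) h.2.1
      simp only [reflect_polyOfCoeff, coeff_neg, coeff_polyOfCoeff] at this
      exact this
    refine ⟨fun x y => ?_, fun x y => ?_⟩
    · rw [← binaryForm_comp_rev c x y, hrev]
      simp [binaryForm]
    -- The line `y = 0` is lost on setting `y = 1`. There the form is its top coefficient times `x ^
    -- d`, and that coefficient is minus the constant one, which is zero.
    · rcases eq_or_ne y 0 with rfl | hy
      · have h0 := eval_zero_of_mem_altPoly h
        rw [← coeff_zero_eq_eval_zero] at h0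
        have h1 := coeff_polyOfCoeff c 0
        have h2 := congrFun hrev 0
        rw [Fin.val_zero, h0] at h1
        simp only [Function.comp_apply, Fin.rev_zero, Pi.neg_apply, ← h1, neg_zero] at h2
        rw [binaryForm_zero_right, binaryForm_zero_right, h2]
        ring
      · rw [binaryForm_eq_pow_mul c _ hy, binaryForm_eq_pow_mul c (y - x) hy,
          ← eval_polyOfCoeff, ← eval_polyOfCoeff, sub_div, div_self hy,
          eval_one_sub_of_mem_altPoly h]
        ring

/-- A functional on the symbols of depth two, as the polynomial with coefficients its values. -/
noncomputable def depthTwoDualEquiv (G : Type) [CommGroup G] [Subsingleton G] (d : ℕ) :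
    Module.Dual ℚ (DihedralGen G (d + 2) 2 →₀ ℚ) ≃ₗ[ℚ] degreeLT ℚ (d + 1) :=
  let _ : Unique G := ⟨⟨1⟩, fun _ => Subsingleton.elim _ _⟩
  (Finsupp.llift ℚ ℚ ℚ (DihedralGen G (d + 2) 2)).symm ≪≫ₗ
    LinearEquiv.funCongrLeft ℚ ℚ ((depthTwoIndex d).trans (Equiv.uniqueProd _ _).symm) ≪≫ₗ
    (degreeLTEquiv ℚ (d + 1)).symm

theorem coe_depthTwoDualEquiv {G : Type} [CommGroup G] [Subsingleton G] {d : ℕ}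
    (φ : Module.Dual ℚ (DihedralGen G (d + 2) 2 →₀ ℚ)) :
    (depthTwoDualEquiv G d φ : ℚ[X]) = polyOfCoeff (depthTwoCoeff φ) := by
  rfl

theorem finrank_dualAnnihilator_of_even {G : Type} [CommGroup G] [Subsingleton G] {d : ℕ}
    (hd : Even d) :
    Module.finrank ℚ (dihedralRelations G (d + 2) 2).dualAnnihilator = d / 6 := by
  have h : (dihedralRelations G (d + 2) 2).dualAnnihilator =
      ((altPoly d).submoduleOf (degreeLT ℚ (d + 1))).comap
        (depthTwoDualEquiv G d : _ →ₗ[ℚ] degreeLT ℚ (d + 1)) := by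
    ext φ
    rw [mem_dualAnnihilator_iff_isDoubleShuffle, isDoubleShuffle_binaryForm_iff,
      ← coe_depthTwoDualEquiv]
    rfl
  rw [h, ((depthTwoDualEquiv G d).ofSubmodule' _).finrank_eq,
    (Submodule.submoduleOfEquivOfLe (altPoly_le_degreeLT d)).finrank_eq, finrank_altPoly hd]

theorem dualAnnihilator_eq_bot_of_odd {G : Type} [CommGroup G] [Subsingleton G] {d : ℕ}
    (hd : Odd d) : (dihedralRelations G (d + 2) 2).dualAnnihilator = ⊥ := by
  rw [eq_bot_iff]
  intro φ hφ
  rw [mem_dualAnnihilator_iff_isDoubleShuffle] at hφ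
  rw [Submodule.mem_bot, ← map_eq_zero_iff _ (depthTwoDualEquiv G d).injective]
  refine Subtype.ext (Polynomial.funext fun x => ?_)
  rw [coe_depthTwoDualEquiv, eval_polyOfCoeff, hφ.eq_zero_of_odd hd]
  simp

instance (G : Type) [CommGroup G] [Subsingleton G] (w m : ℕ) :
    Finite (DihedralGen G w m) := by
  have : Finite G := Finite.of_subsingleton
  infer_instance

/-- The annihilator is the dual of the quotient, which is finite-dimensional because there are
finitely many symbols. -/
theorem rank_dihedralCoalgebra (G : Type) [CommGroup G] [Subsingleton G] (w m : ℕ) :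
    Module.rank ℚ (DihedralCoalgebra ℚ G w m) =
      Module.finrank ℚ (dihedralRelations G w m).dualAnnihilator := by
  rw [← (dihedralRelations G w m).dualQuotEquivDualAnnihilator.finrank_eq,
    Subspace.dual_finrank_eq]
  exact (Module.finrank_eq_rank ℚ (DihedralCoalgebra ℚ G w m)).symm

theorem rank_dihedralCoalgebra_of_odd (G : Type) [CommGroup G] [Subsingleton G] {w : ℕ}
    (hw : 2 ≤ w) (h : Odd w) : Module.rank ℚ (DihedralCoalgebra ℚ G w 2) = 0 := by
  obtain ⟨d, rfl⟩ := Nat.exists_eq_add_of_le' hw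
  have hd : Odd d := by rcases h with ⟨k, hk⟩; exact ⟨k - 1, by omega⟩
  rw [rank_dihedralCoalgebra, dualAnnihilator_eq_bot_of_odd hd, finrank_bot, Nat.cast_zero]

theorem rank_dihedralCoalgebra_of_even (G : Type) [CommGroup G] [Subsingleton G] {w : ℕ}
    (hw : 2 ≤ w) (h : Even w) :
    Module.rank ℚ (DihedralCoalgebra ℚ G w 2) = ((w - 2) / 6 : ℕ) := by
  obtain ⟨d, rfl⟩ := Nat.exists_eq_add_of_le' hw
  have hd : Even d := by rcases h with ⟨k, hk⟩; exact ⟨k - 1, by omega⟩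
  rw [rank_dihedralCoalgebra, finrank_dualAnnihilator_of_even hd, Nat.add_sub_cancel]

end Dimension

/-! ### Stuffle, shuffle and sum formulas for double zeta values. -/

section DoubleZeta

open Finset Filter Topology

theorem HasSum.of_eq {ι : Type*} {f g : ι → ℝ} {a : ℝ} (hf : HasSum f a) (h : ∀ x, f x = g x) :
    HasSum g a :=
  funext h ▸ hf

/-- One of the two parts of the decomposition of `x ^ (a + 1) y ^ (b + 1)` into partial
fractions, where `x y = s (x + y)`. -/
def partialFractionPart {K : Type*} [Field K] (x s : K) (a b : ℕ) : K :=
  ∑ i ∈ range (a + b + 1), ((a + b - i).choose b : K) * (x ^ (i + 1) * s ^ (a + b - i + 1))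

theorem partialFractionPart_succ_succ {K : Type*} [Field K] (x s : K) (a b : ℕ) :
    partialFractionPart x s (a + 1) (b + 1) =
      s * (partialFractionPart x s (a + 1) b + partialFractionPart x s a (b + 1)) := by
  simp only [partialFractionPart]
  rw [show a + 1 + (b + 1) + 1 = (a + b + 2) + 1 by ring, sum_range_succ,
    show a + 1 + b + 1 = a + b + 2 by ring, show a + (b + 1) + 1 = a + b + 2 by ring,
    ← sum_add_distrib, mul_sum,
    show a + 1 + (b + 1) - (a + b + 2) = 0 by omega, Nat.choose_zero_succ, Nat.cast_zero,
    zero_mul, add_zero]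
  refine sum_congr rfl fun i hi => ?_
  rw [mem_range] at hi
  rw [show a + 1 + (b + 1) - i = (a + b + 1 - i) + 1 by omega,
    show a + 1 + b - i = a + b + 1 - i by omega, show a + (b + 1) - i = a + b + 1 - i by omega,
    Nat.choose_succ_succ]
  push_cast
  ring

theorem partialFractionPart_zero_left {K : Type*} [Field K] (x s : K) (b : ℕ) :
    partialFractionPart x s 0 b = x * s ^ (b + 1) := by
  rw [partialFractionPart, sum_eq_single_of_mem 0 (by simp)]
  · simp
  · intro i hi h0
    rw [mem_range] at hi
    rw [Nat.choose_eq_zero_of_lt (by omega), Nat.cast_zero, zero_mul]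

theorem sum_pow_mul_pow_add {K : Type*} [Field K] {x y s : K} (h : x * y = s * (x + y)) (a : ℕ) :
    ∑ i ∈ range (a + 1), x ^ (i + 1) * s ^ (a - i + 1) + y * s ^ (a + 1) = x ^ (a + 1) * y := by
  induction a with
  | zero => simp; linear_combination -h
  | succ a ih =>
    rw [sum_range_succ]
    have : ∑ i ∈ range (a + 1), x ^ (i + 1) * s ^ (a + 1 - i + 1) =
        s * ∑ i ∈ range (a + 1), x ^ (i + 1) * s ^ (a - i + 1) := by
      rw [mul_sum]
      refine sum_congr rfl fun i hi => ?_
      rw [mem_range] at hi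
      rw [show a + 1 - i = a - i + 1 by omega]; ring
    rw [this, Nat.sub_self, zero_add, pow_one]
    linear_combination s * ih - x ^ (a + 1) * h

theorem partialFractionPart_zero_right {K : Type*} [Field K] (x s : K) (a : ℕ) :
    partialFractionPart x s a 0 = ∑ i ∈ range (a + 1), x ^ (i + 1) * s ^ (a - i + 1) := by
  simp [partialFractionPart]

/-- Multiplying by `x y = s (x + y)` lowers one exponent at a time, and Pascal's rule gives the
binomial coefficients. It is applied with `x = 1 / m`, `y = 1 / n`, `s = 1 / (m + n)`. -/
theorem pow_succ_mul_pow_succ_eq {K : Type*} [Field K] {x y s : K} (h : x * y = s * (x + y))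
    (a b : ℕ) :
    x ^ (a + 1) * y ^ (b + 1) = partialFractionPart x s a b + partialFractionPart y s b a := by
  induction a generalizing b with
  | zero =>
    rw [partialFractionPart_zero_left, partialFractionPart_zero_right,
      add_comm (x * _), sum_pow_mul_pow_add (by rw [mul_comm, h, add_comm])]
    ring
  | succ a iha =>
    induction b with
    | zero =>
      rw [partialFractionPart_zero_left, partialFractionPart_zero_right, sum_pow_mul_pow_add h]
      ring
    | succ b ihb =>
      rw [partialFractionPart_succ_succ, partialFractionPart_succ_succ]
      have ha := iha (b + 1)
      linear_combination s * ihb + s * ha + x ^ (a + 1) * y ^ (b + 1) * h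

/-- The terms of the double zeta series, indexed by the pairs `(k₁ - 1, k₂ - k₁ - 1)`. -/
noncomputable def doubleZetaTerm (a b : ℕ) (x : ℕ × ℕ) : ℝ :=
  ((x.1 : ℝ) + 1)⁻¹ ^ a * ((x.1 : ℝ) + x.2 + 2)⁻¹ ^ b

/-- The sum of the double zeta series. -/
noncomputable def doubleZeta (a b : ℕ) : ℝ := ∑' x, doubleZetaTerm a b x

/-- The sum of the series of the `a`-th powers of the inverses of the positive integers. -/
noncomputable def simpleZeta (a : ℕ) : ℝ := ∑' p : ℕ, ((p : ℝ) + 1)⁻¹ ^ a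

theorem hasSum_simpleZeta {a : ℕ} (ha : 2 ≤ a) :
    HasSum (fun p : ℕ => ((p : ℝ) + 1)⁻¹ ^ a) (simpleZeta a) := by
  refine Summable.hasSum ?_
  have := (summable_nat_add_iff 1).2 (Real.summable_nat_pow_inv.2 (by omega : 1 < a))
  simpa only [Nat.cast_add, Nat.cast_one, inv_pow] using this

theorem summable_inv_mul_sqrt :
    Summable fun p : ℕ => (((p : ℝ) + 1) * √((p : ℝ) + 1))⁻¹ := by
  have := (summable_nat_add_iff 1).2
    (Real.summable_nat_rpow_inv.2 (by norm_num : (1 : ℝ) < 1 + 1 / 2))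
  refine this.congr fun p => ?_
  have hp : (0 : ℝ) < (p : ℝ) + 1 := by positivity
  rw [Nat.cast_add, Nat.cast_one, Real.rpow_add hp, Real.rpow_one, Real.sqrt_eq_rpow]

theorem doubleZetaTerm_nonneg (a b : ℕ) (x : ℕ × ℕ) : 0 ≤ doubleZetaTerm a b x := by
  unfold doubleZetaTerm; positivity

theorem hasSum_doubleZeta {a b : ℕ} (ha : 1 ≤ a) (hb : 2 ≤ b) :
    HasSum (doubleZetaTerm a b) (doubleZeta a b) := by
  refine Summable.hasSum ?_
  refine Summable.of_nonneg_of_le (doubleZetaTerm_nonneg a b) ?_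
    (summable_inv_mul_sqrt.mul_of_nonneg summable_inv_mul_sqrt
      (fun p => by positivity) (fun p => by positivity))
  rintro ⟨p, q⟩
  have hp : (1 : ℝ) ≤ (p : ℝ) + 1 := by simp
  have hq : (1 : ℝ) ≤ (q : ℝ) + 1 := by simp
  set m : ℝ := (p : ℝ) + 1 with hm
  set n : ℝ := (q : ℝ) + 1 with hn
  have hs : (p : ℝ) + q + 2 = m + n := by rw [hm, hn]; ring
  have h1 : doubleZetaTerm a b (p, q) ≤ m⁻¹ ^ 1 * (m + n)⁻¹ ^ 2 := by
    unfold doubleZetaTerm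
    simp only [hs]
    have := inv_le_one_of_one_le₀ hp
    have := inv_le_one_of_one_le₀ (by linarith : 1 ≤ m + n)
    gcongr ?_ * ?_
    · exact pow_le_pow_of_le_one (by positivity) (by assumption) ha
    · exact pow_le_pow_of_le_one (by positivity) (by assumption) hb
  refine h1.trans ?_
  rw [← mul_inv, pow_one, inv_pow, ← mul_inv]
  apply inv_anti₀ (by positivity)
  -- This bounds the term by `(m n) ^ (-3 / 2)`, the product of two convergent series.
  have hsq : √m * √n ≤ m + n := by
    rw [← Real.sqrt_mul (by linarith), Real.sqrt_le_left (by linarith)]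
    nlinarith
  calc m * √m * (n * √n) = m * (n * (√m * √n)) := by ring
    _ ≤ m * ((m + n) * (m + n)) := by gcongr; linarith
    _ = m * (m + n) ^ 2 := by ring

/-- The decomposition of `ℕ × ℕ` into the parts above, below and on the diagonal. -/
def trichotomyMap : ((ℕ × ℕ) ⊕ (ℕ × ℕ)) ⊕ ℕ → ℕ × ℕ :=
  Sum.elim (Sum.elim (fun x => (x.1, x.1 + x.2 + 1)) (fun x => (x.1 + x.2 + 1, x.1)))
    (fun p => (p, p))

theorem bijective_trichotomyMap : Function.Bijective trichotomyMap := by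
  constructor
  · rintro ((⟨p, q⟩ | ⟨p, q⟩) | p) ((⟨r, s⟩ | ⟨r, s⟩) | r) h <;>
      simp only [trichotomyMap, Sum.elim_inl, Sum.elim_inr, Prod.mk.injEq] at h <;>
      simp only [Sum.inl.injEq, Sum.inr.injEq, Prod.mk.injEq, reduceCtorEq] <;> omega
  · rintro ⟨p, q⟩
    rcases lt_trichotomy p q with h | h | h
    · refine ⟨.inl (.inl (p, q - p - 1)), Prod.ext rfl ?_⟩
      change p + (q - p - 1) + 1 = q
      omega
    · exact ⟨.inr p, Prod.ext rfl h⟩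
    · refine ⟨.inl (.inr (q, p - q - 1)), Prod.ext ?_ rfl⟩
      change q + (p - q - 1) + 1 = p
      omega

theorem hasSum_nat_prod {f : ℕ × ℕ → ℝ} {a b c : ℝ}
    (ha : HasSum (fun x : ℕ × ℕ => f (x.1, x.1 + x.2 + 1)) a)
    (hb : HasSum (fun x : ℕ × ℕ => f (x.1 + x.2 + 1, x.1)) b)
    (hc : HasSum (fun p => f (p, p)) c) : HasSum f (a + b + c) :=
  (Equiv.ofBijective _ bijective_trichotomyMap).hasSum_iff.1
    (HasSum.sum (f := f ∘ trichotomyMap)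
      (HasSum.sum (f := (f ∘ trichotomyMap) ∘ Sum.inl) ha hb) hc)

/-- The stuffle relation for double zeta values. -/
theorem simpleZeta_mul_simpleZeta_stuffle {a b : ℕ} (ha : 2 ≤ a) (hb : 2 ≤ b) :
    simpleZeta a * simpleZeta b = doubleZeta a b + doubleZeta b a + simpleZeta (a + b) := by
  have hs := (hasSum_simpleZeta ha).summable.mul_of_nonneg (hasSum_simpleZeta hb).summable
    (fun p => by positivity) (fun p => by positivity)
  refine ((hasSum_simpleZeta ha).mul (hasSum_simpleZeta hb) hs).unique (hasSum_nat_prod ?_ ?_ ?_)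
  · refine HasSum.of_eq (hasSum_doubleZeta (by omega : 1 ≤ a) hb) fun x => ?_
    simp only [doubleZetaTerm]
    push_cast; ring
  · refine HasSum.of_eq (hasSum_doubleZeta (by omega : 1 ≤ b) ha) fun x => ?_
    simp only [doubleZetaTerm]
    push_cast; ring
  · exact HasSum.of_eq (hasSum_simpleZeta (by omega : 2 ≤ a + b)) fun p => pow_add _ _ _

theorem inv_mul_inv_eq (x : ℕ × ℕ) :
    ((x.1 : ℝ) + 1)⁻¹ * ((x.2 : ℝ) + 1)⁻¹ =
      ((x.1 : ℝ) + x.2 + 2)⁻¹ * (((x.1 : ℝ) + 1)⁻¹ + ((x.2 : ℝ) + 1)⁻¹) := by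
  have h1 : (x.1 : ℝ) + 1 ≠ 0 := by positivity
  have h2 : (x.2 : ℝ) + 1 ≠ 0 := by positivity
  have h3 : (x.1 : ℝ) + x.2 + 2 ≠ 0 := by positivity
  field_simp
  ring

theorem hasSum_partialFractionPart {a b : ℕ} (hb : 1 ≤ b) :
    HasSum (fun x : ℕ × ℕ => partialFractionPart ((x.1 : ℝ) + 1)⁻¹ ((x.1 : ℝ) + x.2 + 2)⁻¹ a b)
      (∑ i ∈ range (a + b + 1), ((a + b - i).choose b : ℝ) * doubleZeta (i + 1) (a + b - i + 1)) := by
  refine hasSum_sum fun i _ => ?_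
  rcases Nat.lt_or_ge (a + b - i) b with h | h
  · simp only [Nat.choose_eq_zero_of_lt h, Nat.cast_zero, zero_mul]
    exact hasSum_zero
  · exact (hasSum_doubleZeta (by omega) (by omega)).mul_left _

/-- The shuffle relation for double zeta values. -/
theorem simpleZeta_mul_simpleZeta_shuffle {a b : ℕ} (ha : 1 ≤ a) (hb : 1 ≤ b) :
    simpleZeta (a + 1) * simpleZeta (b + 1) =
      ∑ i ∈ range (a + b + 1), (((a + b - i).choose b : ℝ) + ((a + b - i).choose a : ℝ)) *
        doubleZeta (i + 1) (a + b - i + 1) := by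
  have ha' := hasSum_simpleZeta (by omega : 2 ≤ a + 1)
  have hb' := hasSum_simpleZeta (by omega : 2 ≤ b + 1)
  have hs := ha'.summable.mul_of_nonneg hb'.summable
    (fun p => by positivity) (fun p => by positivity)
  refine (ha'.mul hb' hs).unique ?_
  have h1 := hasSum_partialFractionPart (a := a) hb
  have h2 := (Equiv.prodComm ℕ ℕ).hasSum_iff.2 (hasSum_partialFractionPart (a := b) ha)
  simp only [add_comm b a] at h2
  simp only [add_mul, sum_add_distrib]
  refine HasSum.of_eq (h1.add h2) fun x => ?_
  rw [pow_succ_mul_pow_succ_eq (inv_mul_inv_eq x)]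
  simp only [Function.comp_apply, Equiv.prodComm_apply, Prod.fst_swap, Prod.snd_swap,
    add_comm (x.2 : ℝ) x.1]

theorem hasSum_sub_add {f : ℕ → ℝ} (hf : Antitone f) (h0 : Tendsto f atTop (𝓝 0)) (m : ℕ) :
    HasSum (fun n => f n - f (n + m)) (∑ j ∈ range m, f j) := by
  rw [hasSum_iff_tendsto_nat_of_nonneg fun n => sub_nonneg.2 (hf (Nat.le_add_right n m))]
  have h : ∀ n, ∑ i ∈ range n, (f i - f (i + m)) =
      ∑ j ∈ range m, f j - ∑ j ∈ range m, f (n + j) := fun n => by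
    have h1 := sum_range_add f n m
    have h2 := sum_range_add f m n
    rw [add_comm m n] at h2
    simp only [add_comm _ m]
    rw [sum_sub_distrib]
    linarith
  simp only [h]
  have : Tendsto (fun n => ∑ j ∈ range m, f (n + j)) atTop (𝓝 (∑ j ∈ range m, 0)) :=
    tendsto_finsetSum _ fun j _ => h0.comp (tendsto_add_atTop_nat j)
  simpa using tendsto_const_nhds.sub this

/-- With `m = p + 1`, `1 / (n (m + n)) = (1 / n - 1 / (m + n)) / m` telescopes to a harmonic number.
-/
theorem hasSum_inv_mul_inv (p : ℕ) :
    HasSum (fun q : ℕ => ((q : ℝ) + 1)⁻¹ * ((p : ℝ) + q + 2)⁻¹)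
      (((p : ℝ) + 1)⁻¹ * ∑ j ∈ range (p + 1), ((j : ℝ) + 1)⁻¹) := by
  have h := (hasSum_sub_add (f := fun n : ℕ => ((n : ℝ) + 1)⁻¹)
    (fun m n h => by
      have : (m : ℝ) ≤ n := by exact_mod_cast h
      dsimp only; gcongr)
    (by simpa only [one_div] using tendsto_one_div_add_atTop_nhds_zero_nat (𝕜 := ℝ))
    (p + 1)).mul_left ((p : ℝ) + 1)⁻¹
  refine HasSum.of_eq h fun q => ?_
  have h1 : (q : ℝ) + 1 ≠ 0 := by positivity
  have h2 : (p : ℝ) + 1 ≠ 0 := by positivity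
  have h3 : (p : ℝ) + q + 2 ≠ 0 := by positivity
  have h4 : ((q + (p + 1) : ℕ) : ℝ) + 1 = p + q + 2 := by push_cast; ring
  rw [h4]
  field_simp
  ring

theorem hasSum_doubleZeta_one {d : ℕ} (hd : 1 ≤ d) :
    HasSum (fun p : ℕ => ((p : ℝ) + 1)⁻¹ ^ (d + 1) * ∑ j ∈ range p, ((j : ℝ) + 1)⁻¹)
      (doubleZeta 1 (d + 1)) := by
  have h := (HasAntidiagonal.sigmaAntidiagonalEquivProd (A := ℕ)).hasSum_iff.2
    (hasSum_doubleZeta le_rfl (by omega : 2 ≤ d + 1))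
  have h' := h.sigma fun n => Finset.hasSum (antidiagonal n) (doubleZetaTerm 1 (d + 1))
  rw [← hasSum_nat_add_iff' 1]
  simp only [range_one, sum_singleton, range_zero, sum_empty, mul_zero, sub_zero]
  refine HasSum.of_eq h' fun n => ?_
  rw [Nat.sum_antidiagonal_eq_sum_range_succ_mk, mul_sum]
  refine sum_congr rfl fun j hj => ?_
  rw [mem_range] at hj
  simp only [doubleZetaTerm, pow_one]
  rw [mul_comm, Nat.cast_sub (by omega)]
  push_cast
  -- Grouping by antidiagonals fixes the larger summation variable; the term `p = 0`, an empty sum,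
  -- was split off above.
  congr 3
  ring

/-- Euler's sum formula for double zeta values. -/
theorem sum_doubleZeta {d : ℕ} (hd : 1 ≤ d) :
    ∑ i ∈ range d, doubleZeta (i + 1) (d - i + 1) = simpleZeta (d + 2) := by
  -- The sum of `1 / (m ^ d n (m + n))` is computed twice: by partial fractions here, and in `h2` by
  -- summing over `n` first. The extra `ζ(1, d + 1)` occurs on both sides and cancels.
  have h1 : HasSum (fun x : ℕ × ℕ => ((x.1 : ℝ) + 1)⁻¹ ^ d *
      (((x.2 : ℝ) + 1)⁻¹ * ((x.1 : ℝ) + x.2 + 2)⁻¹))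
      (∑ i ∈ range d, doubleZeta (i + 1) (d - i + 1) + doubleZeta 1 (d + 1)) := by
    have ha : HasSum (fun x => ∑ i ∈ range d, doubleZetaTerm (i + 1) (d - i + 1) x)
        (∑ i ∈ range d, doubleZeta (i + 1) (d - i + 1)) := hasSum_sum fun i hi => by
      rw [mem_range] at hi
      exact hasSum_doubleZeta (by omega) (by omega)
    have hb := (Equiv.prodComm ℕ ℕ).hasSum_iff.2
      (hasSum_doubleZeta le_rfl (by omega : 2 ≤ d + 1))
    refine HasSum.of_eq (ha.add hb) fun x => ?_
    obtain ⟨e, rfl⟩ := Nat.exists_eq_add_of_le' hd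
    have := sum_pow_mul_pow_add (inv_mul_inv_eq x) e
    rw [← mul_assoc, ← this, add_mul, sum_mul]
    congr 1
    · refine sum_congr rfl fun i hi => ?_
      rw [mem_range] at hi
      rw [doubleZetaTerm, show e + 1 - i = e - i + 1 by omega]
      ring
    · simp only [Function.comp_apply, Equiv.prodComm_apply, Prod.fst_swap, Prod.snd_swap,
        doubleZetaTerm, add_comm (x.2 : ℝ) x.1]
      ring
  have h2 := h1.prod_fiberwise fun p => (hasSum_inv_mul_inv p).mul_left (((p : ℝ) + 1)⁻¹ ^ d)
  have h3 := (hasSum_doubleZeta_one hd).add (hasSum_simpleZeta (by omega : 2 ≤ d + 2))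
  have h4 := h2.unique (HasSum.of_eq h3 fun p => ?_)
  · linarith
  · rw [sum_range_succ]
    ring

end DoubleZeta

/-! ### Comparison of the reduced zeta space with the coalgebra. -/

section ReducedZeta

/-- The pair `(k₁, k₂)`, `0 < k₁ < k₂`, in terms of `k₁ - 1` and `k₂ - k₁ - 1`. -/
def strictPairEquiv : ℕ × ℕ ≃ {k : Fin 2 → ℕ // StrictMono k ∧ ∀ i, 0 < k i} where
  toFun x := ⟨![x.1 + 1, x.1 + x.2 + 2], by
    rw [Fin.strictMono_iff_lt_succ, Fin.forall_fin_two]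
    simp only [Fin.forall_fin_one, Fin.castSucc_zero, Fin.succ_zero_eq_one,
      Matrix.cons_val_zero, Matrix.cons_val_one, Matrix.cons_val_fin_one]
    omega⟩
  invFun k := (k.1 0 - 1, k.1 1 - k.1 0 - 1)
  left_inv x := by
    refine Prod.ext ?_ ?_
    · simp
    · simp only [Matrix.cons_val_zero, Matrix.cons_val_one, Matrix.cons_val_fin_one]; omega
  right_inv k := by
    have h0 := k.2.2 0
    have h1 := k.2.1 (by decide : (0 : Fin 2) < 1)
    refine Subtype.ext (funext fun j => ?_)
    fin_cases j
    · simp only [Fin.zero_eta, Matrix.cons_val_zero]; omega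
    · simp only [Fin.mk_one, Matrix.cons_val_one, Matrix.cons_val_fin_one]; omega

/-- The positive integer `k`, in terms of `k - 1`. -/
def posSingleEquiv : ℕ ≃ {k : Fin 1 → ℕ // StrictMono k ∧ ∀ i, 0 < k i} where
  toFun p := ⟨![p + 1], Subsingleton.strictMono _, by simp⟩
  invFun k := k.1 0 - 1
  left_inv p := by simp
  right_inv k := by
    have h0 := k.2.2 0
    refine Subtype.ext (funext fun j => ?_)
    fin_cases j
    simp only [Fin.zero_eta, Matrix.cons_val_zero]; omega

theorem multiZeta_two (n : Fin 2 → ℕ) : multiZeta n = doubleZeta (n 0) (n 1) := by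
  rw [multiZeta, ← strictPairEquiv.tsum_eq, doubleZeta]
  refine tsum_congr fun x => ?_
  rw [Fin.prod_univ_two, doubleZetaTerm, inv_pow, inv_pow, one_div, one_div]
  simp [strictPairEquiv]

theorem multiZeta_one (n : Fin 1 → ℕ) : multiZeta n = simpleZeta (n 0) := by
  rw [multiZeta, ← posSingleEquiv.tsum_eq, simpleZeta]
  refine tsum_congr fun x => ?_
  rw [Fin.prod_univ_one, inv_pow, one_div]
  simp [posSingleEquiv]

/-- The inverse of the normalizing factor `(2πi) ^ w`. -/
noncomputable def zetaNorm (w : ℕ) : ℂ := ((2 * (Real.pi : ℂ) * Complex.I) ^ w)⁻¹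

theorem zetaNorm_add (a b : ℕ) : zetaNorm (a + b) = zetaNorm a * zetaNorm b := by
  rw [zetaNorm, pow_add, mul_inv]; rfl

theorem simpleZeta_mem_zetaSpan {a : ℕ} (ha : 2 ≤ a) :
    zetaNorm a * (simpleZeta a : ℂ) ∈ zetaSpan a 1 := by
  refine Submodule.subset_span ⟨1, ![a], le_rfl, ⟨?_, ?_⟩, ?_, ?_⟩
  · simp; omega
  · simp [ha]
  · simp
  · rw [normalizedZeta, multiZeta_one]; simp [zetaNorm]

theorem doubleZeta_mem_zetaSpan {a b : ℕ} (ha : 1 ≤ a) (hb : 2 ≤ b) :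
    zetaNorm (a + b) * (doubleZeta a b : ℂ) ∈ zetaSpan (a + b) 2 := by
  refine Submodule.subset_span ⟨2, ![a, b], le_rfl, ⟨?_, ?_⟩, ?_, ?_⟩
  · rw [Fin.forall_fin_two]; simp; omega
  · rw [Fin.forall_fin_two]; simp [hb]
  · simp
  · rw [normalizedZeta, multiZeta_two]; simp [zetaNorm]

/-- The subspace divided out in `ReducedZeta`. -/
noncomputable abbrev zetaKernel (w m : ℕ) : Submodule ℚ ℂ := zetaLower w m ⊔ zetaProducts w m

theorem zetaSpan_one_le_zetaKernel (w : ℕ) : zetaSpan w 1 ≤ zetaKernel w 2 :=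
  (le_iSup (fun m' : Fin 2 => zetaSpan w m') 1).trans (le_sup_right.trans le_sup_left)

theorem simpleZeta_mem_zetaKernel {w : ℕ} (hw : 2 ≤ w) :
    zetaNorm w * (simpleZeta w : ℂ) ∈ zetaKernel w 2 :=
  zetaSpan_one_le_zetaKernel w (simpleZeta_mem_zetaSpan hw)

theorem simpleZeta_mul_mem_zetaKernel {a b : ℕ} (ha : 2 ≤ a) (hb : 2 ≤ b) :
    zetaNorm (a + b) * ((simpleZeta a * simpleZeta b : ℝ) : ℂ) ∈ zetaKernel (a + b) 2 := by
  have h : zetaSpan a 1 * zetaSpan b 1 ≤ zetaProducts (a + b) 2 :=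
    le_iSup_of_le a <| le_iSup_of_le b <| le_iSup_of_le 1 <| le_iSup_of_le 1 <|
      le_iSup_of_le ⟨by omega, by omega, one_pos, one_pos, rfl, rfl⟩ le_rfl
  refine Submodule.mem_sup_right (h ?_)
  rw [zetaNorm_add, Complex.ofReal_mul, mul_mul_mul_comm]
  exact Submodule.mul_mem_mul (simpleZeta_mem_zetaSpan ha) (simpleZeta_mem_zetaSpan hb)

/-- The normalized double zeta value at `(i + 1, d - i + 1)`; the divergent value at `(d + 1, 1)`
is replaced by the opposite of the value at `(1, d + 1)`. -/
noncomputable def regDoubleZeta (d : ℕ) (i : ℕ) : ℂ :=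
  if i < d then zetaNorm (d + 2) * (doubleZeta (i + 1) (d - i + 1) : ℂ)
  else if 0 < d then -(zetaNorm (d + 2) * (doubleZeta 1 (d + 1) : ℂ)) else 0

theorem regDoubleZeta_of_lt {d i : ℕ} (h : i < d) :
    regDoubleZeta d i = zetaNorm (d + 2) * (doubleZeta (i + 1) (d - i + 1) : ℂ) := if_pos h

theorem regDoubleZeta_self (d : ℕ) : regDoubleZeta d d = -regDoubleZeta d 0 := by
  rcases Nat.eq_zero_or_pos d with rfl | h
  · simp [regDoubleZeta]
  · simp [regDoubleZeta, h]

theorem regDoubleZeta_mem_zetaSpan {d i : ℕ} (hi : i ≤ d) :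
    regDoubleZeta d i ∈ zetaSpan (d + 2) 2 := by
  have h : ∀ i < d, regDoubleZeta d i ∈ zetaSpan (d + 2) 2 := fun i hi => by
    have := doubleZeta_mem_zetaSpan (by omega : 1 ≤ i + 1) (by omega : 2 ≤ d - i + 1)
    rw [regDoubleZeta_of_lt hi]
    rwa [show i + 1 + (d - i + 1) = d + 2 by omega] at this
  rcases hi.lt_or_eq with h' | rfl
  · exact h i h'
  · rcases Nat.eq_zero_or_pos i with rfl | h'
    · simp [regDoubleZeta]
    · rw [regDoubleZeta_self]
      exact neg_mem (h 0 h')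

theorem regDoubleZeta_add_mem_zetaKernel {d i : ℕ} (hi : i ≤ d) :
    regDoubleZeta d i + regDoubleZeta d (d - i) ∈ zetaKernel (d + 2) 2 := by
  rcases Nat.eq_zero_or_pos i with rfl | h0
  · rw [Nat.sub_zero, regDoubleZeta_self, add_neg_cancel]
    exact zero_mem _
  rcases hi.lt_or_eq with h | rfl
  · have h1 := simpleZeta_mul_mem_zetaKernel (by omega : 2 ≤ i + 1) (by omega : 2 ≤ d - i + 1)
    rw [simpleZeta_mul_simpleZeta_stuffle (by omega) (by omega),
      show i + 1 + (d - i + 1) = d + 2 by omega] at h1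
    have := sub_mem h1 (simpleZeta_mem_zetaKernel (by omega : 2 ≤ d + 2))
    rw [regDoubleZeta_of_lt h, regDoubleZeta_of_lt (by omega), show d - (d - i) = i by omega]
    convert this using 1
    push_cast
    ring
  · rw [Nat.sub_self, regDoubleZeta_self, neg_add_cancel]
    exact zero_mem _

/-- The first binomial only contributes the term `i = 0`, which cancels the regularized term `i =
d`. What remains is Euler's sum, of depth one. -/
theorem sum_regDoubleZeta_mem_zetaKernel_of_zero (d : ℕ) :
    ∑ i ∈ Finset.range (d + 1), (((d - i).choose d : ℂ) + ((d - i).choose 0 : ℂ)) *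
      regDoubleZeta d i ∈ zetaKernel (d + 2) 2 := by
  rcases Nat.eq_zero_or_pos d with rfl | hd
  · simp [regDoubleZeta]
  have h := simpleZeta_mem_zetaKernel (by omega : 2 ≤ d + 2)
  rw [← sum_doubleZeta hd] at h
  convert h using 1
  simp only [add_mul, Finset.sum_add_distrib, Nat.choose_zero_right, Nat.cast_one, one_mul]
  rw [Finset.sum_eq_single_of_mem 0 (by simp) fun i hi h0 => by
    rw [Nat.choose_eq_zero_of_lt (by omega), Nat.cast_zero, zero_mul],
    Finset.sum_range_succ, regDoubleZeta_self, Nat.sub_zero, Nat.choose_self, Nat.cast_one, one_mul,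
    add_comm, add_assoc, neg_add_cancel, add_zero, Complex.ofReal_sum, Finset.mul_sum]
  exact Finset.sum_congr rfl fun i hi => regDoubleZeta_of_lt (Finset.mem_range.1 hi)

theorem sum_regDoubleZeta_mem_zetaKernel {d j : ℕ} (hj : j ≤ d) :
    ∑ i ∈ Finset.range (d + 1), (((d - i).choose (d - j) : ℂ) + ((d - i).choose j : ℂ)) *
      regDoubleZeta d i ∈ zetaKernel (d + 2) 2 := by
  rcases Nat.eq_zero_or_pos j with rfl | h0
  · exact sum_regDoubleZeta_mem_zetaKernel_of_zero d
  rcases hj.lt_or_eq with h | rfl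
  · have h1 := simpleZeta_mul_mem_zetaKernel (by omega : 2 ≤ j + 1) (by omega : 2 ≤ d - j + 1)
    rw [simpleZeta_mul_simpleZeta_shuffle (by omega) (by omega),
      show j + 1 + (d - j + 1) = d + 2 by omega, show j + (d - j) = d by omega] at h1
    convert h1 using 1
    rw [Complex.ofReal_sum, Finset.mul_sum]
    refine Finset.sum_congr rfl fun i hi => ?_
    rw [Finset.mem_range] at hi
    rcases (Nat.lt_succ_iff.1 hi).lt_or_eq with hi' | rfl
    · rw [regDoubleZeta_of_lt hi']; push_cast; ring
    -- For `0 < j < d` the regularized value has coefficient zero, so its choice does not matter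
    -- here.
    · rw [Nat.sub_self, Nat.choose_eq_zero_of_lt (by omega), Nat.choose_eq_zero_of_lt (by omega)]
      simp
  · have := sum_regDoubleZeta_mem_zetaKernel_of_zero j
    simpa only [Nat.sub_self, add_comm] using this

theorem zetaSpan_le_span_regDoubleZeta (d : ℕ) :
    zetaSpan (d + 2) 2 ≤
      Submodule.span ℚ (Set.range fun i : Fin (d + 1) => regDoubleZeta d i) ⊔
        zetaKernel (d + 2) 2 := by
  refine Submodule.span_le.2 ?_
  rintro _ ⟨m, n, hm, hn, hw, rfl⟩
  rcases hm.lt_or_eq with hm' | rfl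
  · refine Submodule.mem_sup_right (Submodule.mem_sup_left (Submodule.mem_sup_right ?_))
    exact le_iSup (fun m' : Fin 2 => zetaSpan (d + 2) m') ⟨m, hm'⟩
      (Submodule.subset_span ⟨m, n, le_rfl, hn, hw, rfl⟩)
  rcases hw.lt_or_eq with hw' | hw'
  · refine Submodule.mem_sup_right (Submodule.mem_sup_left (Submodule.mem_sup_left ?_))
    exact le_iSup (fun w' : Fin (d + 2) => zetaSpan w' 2) ⟨_, hw'⟩
      (Submodule.subset_span ⟨2, n, le_rfl, hn, le_rfl, rfl⟩)
  · have h0 := hn.1 0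
    have h1 := hn.2 1 rfl
    have h2 := hw'
    rw [Fin.sum_univ_two] at h2
    refine Submodule.mem_sup_left
      (Submodule.subset_span ⟨⟨n 0 - 1, by omega⟩, ?_⟩)
    dsimp only
    rw [regDoubleZeta_of_lt (by omega), normalizedZeta, multiZeta_two, hw', zetaNorm,
      show n 0 - 1 + 1 = n 0 by omega, show d - (n 0 - 1) + 1 = n 1 by omega]

/-- The binomial theorem produces the same coefficients as the shuffle formula, which identifies the
latter with the second functional equation. -/
theorem binaryForm_add_right {d : ℕ} (c : Fin (d + 1) → ℚ) (x y : ℚ) :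
    binaryForm c x (x + y) =
      ∑ j : Fin (d + 1), (∑ i : Fin (d + 1), ((d - i : ℕ).choose (d - j) : ℚ) * c i) *
        (x ^ (j : ℕ) * y ^ (d - j : ℕ)) := by
  simp only [binaryForm, Finset.sum_mul]
  rw [Finset.sum_comm]
  refine Finset.sum_congr rfl fun i _ => ?_
  have hr : Finset.range (d + 1) = Finset.range ((i : ℕ) + (d - i + 1)) := by
    congr 1; have := i.2; omega
  rw [← Finset.sum_range fun j => ((d - i : ℕ).choose (d - j) : ℚ) * c i * (x ^ j * y ^ (d - j)),
    hr, Finset.sum_range_add,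
    Finset.sum_eq_zero fun j hj => by
      rw [Finset.mem_range] at hj
      rw [Nat.choose_eq_zero_of_lt (by omega), Nat.cast_zero, zero_mul, zero_mul],
    zero_add, add_pow, Finset.mul_sum, Finset.mul_sum]
  refine Finset.sum_congr rfl fun k hk => ?_
  rw [Finset.mem_range] at hk
  rw [show d - ((i : ℕ) + k) = d - i - k by omega, Nat.choose_symm (by omega), pow_add]
  ring

theorem isDoubleShuffle_binaryForm {d : ℕ} {c : Fin (d + 1) → ℚ}
    (h1 : ∀ i : Fin (d + 1), c i + c i.rev = 0)
    (h2 : ∀ j : Fin (d + 1), ∑ i : Fin (d + 1),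
      (((d - i : ℕ).choose (d - j) : ℚ) + ((d - i : ℕ).choose j : ℚ)) * c i = 0) :
    IsDoubleShuffle (binaryForm c) := by
  have h2' : ∀ x y, binaryForm c x (x + y) + binaryForm c y (x + y) = 0 := fun x y => by
    rw [binaryForm_add_right, add_comm x y, binaryForm_add_right, ← Equiv.sum_comp Fin.revPerm,
      ← Finset.sum_add_distrib]
    refine Finset.sum_eq_zero fun j _ => ?_
    have hj := j.2
    simp only [Fin.revPerm_apply, Fin.val_rev]
    rw [show d - (d + 1 - (j + 1)) = (j : ℕ) by omega, show d + 1 - ((j : ℕ) + 1) = d - j by omega,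
      mul_comm (x ^ _), ← add_mul, ← Finset.sum_add_distrib]
    refine mul_eq_zero_of_left ?_ _
    rw [← h2 j]
    exact Finset.sum_congr rfl fun i _ => by ring
  refine ⟨fun x y => ?_, fun x y => ?_⟩
  · have : c ∘ Fin.rev = -c := funext fun i => by
      have := h1 i
      simp only [Function.comp_apply, Pi.neg_apply]
      linarith
    rw [← binaryForm_comp_rev c x y, this]
    simp [binaryForm]
  · have := h2' x (y - x)
    rw [add_sub_cancel] at this
    linarith

/-- The class in `ReducedZeta` of a regularized double zeta value. -/
noncomputable def regDoubleZetaClass (d : ℕ) (i : Fin (d + 1)) : ReducedZeta (d + 2) 2 :=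
  Submodule.mkQ _ ⟨regDoubleZeta d i, regDoubleZeta_mem_zetaSpan (Nat.lt_succ_iff.1 i.2)⟩

theorem sum_smul_regDoubleZetaClass {d : ℕ} (a : Fin (d + 1) → ℚ)
    (h : ∑ i : Fin (d + 1), (a i : ℂ) * regDoubleZeta d i ∈ zetaKernel (d + 2) 2) :
    ∑ i, a i • regDoubleZetaClass d i = 0 := by
  simp only [regDoubleZetaClass, ← map_smul, ← map_sum]
  rw [Submodule.mkQ_apply, Submodule.Quotient.mk_eq_zero, Submodule.submoduleOf, Submodule.mem_comap]
  convert h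
  simp [Rat.smul_def]

theorem regDoubleZetaClass_add_rev {d : ℕ} (i : Fin (d + 1)) :
    regDoubleZetaClass d i + regDoubleZetaClass d i.rev = 0 := by
  rw [regDoubleZetaClass, regDoubleZetaClass, ← map_add, Submodule.mkQ_apply,
    Submodule.Quotient.mk_eq_zero, Submodule.submoduleOf, Submodule.mem_comap]
  have hi := i.2
  have := regDoubleZeta_add_mem_zetaKernel (Nat.lt_succ_iff.1 hi)
  rw [show d - (i : ℕ) = i.rev by rw [Fin.val_rev]; omega] at this
  exact this

theorem isDoubleShuffle_dual_regDoubleZetaClass {d : ℕ}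
    (f : Module.Dual ℚ (ReducedZeta (d + 2) 2)) :
    IsDoubleShuffle (binaryForm fun i => f (regDoubleZetaClass d i)) := by
  refine isDoubleShuffle_binaryForm (fun i => ?_) fun j => ?_
  · rw [← map_add, regDoubleZetaClass_add_rev, map_zero]
  · have h := sum_regDoubleZeta_mem_zetaKernel (Nat.lt_succ_iff.1 j.2)
    rw [Finset.sum_range] at h
    have := congrArg f (sum_smul_regDoubleZetaClass (fun i : Fin (d + 1) =>
      ((d - i : ℕ).choose (d - j) : ℚ) + ((d - i : ℕ).choose j : ℚ)) (by exact_mod_cast h))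
    simpa only [map_sum, map_smul, smul_eq_mul, map_zero] using this

theorem span_regDoubleZetaClass (d : ℕ) :
    Submodule.span ℚ (Set.range (regDoubleZetaClass d)) = ⊤ := by
  rw [eq_top_iff]
  rintro x -
  obtain ⟨⟨x, hx⟩, rfl⟩ := Submodule.mkQ_surjective _ x
  obtain ⟨y, hy, z, hz, rfl⟩ := Submodule.mem_sup.1 (zetaSpan_le_span_regDoubleZeta d hx)
  obtain ⟨a, rfl⟩ := (Submodule.mem_span_range_iff_exists_fun ℚ).1 hy
  rw [Submodule.mem_span_range_iff_exists_fun]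
  refine ⟨a, ?_⟩
  simp only [regDoubleZetaClass, ← map_smul, ← map_sum]
  rw [← sub_eq_zero, ← map_sub, Submodule.mkQ_apply, Submodule.Quotient.mk_eq_zero,
    Submodule.submoduleOf, Submodule.mem_comap]
  simpa [Submodule.coe_sum] using neg_mem hz

/-- The map sending the symbols of depth two to the classes of double zeta values. -/
noncomputable def depthTwoToZeta (G : Type) (d : ℕ) :
    (DihedralGen G (d + 2) 2 →₀ ℚ) →ₗ[ℚ] ReducedZeta (d + 2) 2 :=
  Finsupp.linearCombination ℚ fun n => regDoubleZetaClass d ((depthTwoIndex d).symm n.2)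

/-- Functionals separate points, so it suffices that each functional on the target pulls back to a
form satisfying the double shuffle equations. -/
theorem dihedralRelations_le_ker_depthTwoToZeta (G : Type) [CommGroup G] [Subsingleton G]
    (d : ℕ) : dihedralRelations G (d + 2) 2 ≤ LinearMap.ker (depthTwoToZeta G d) := by
  intro c hc
  rw [LinearMap.mem_ker, ← Module.forall_dual_apply_eq_zero_iff ℚ]
  intro f
  have h : f ∘ₗ depthTwoToZeta G d ∈ (dihedralRelations G (d + 2) 2).dualAnnihilator := by
    rw [mem_dualAnnihilator_iff_isDoubleShuffle]
    convert isDoubleShuffle_dual_regDoubleZetaClass f using 2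
    funext i
    simp [depthTwoCoeff, depthTwoToZeta]
  exact (Submodule.mem_dualAnnihilator _).1 h c hc

theorem rank_reducedZeta_le (G : Type) [CommGroup G] [Subsingleton G] {w : ℕ} (hw : 2 ≤ w) :
    Module.rank ℚ (ReducedZeta w 2) ≤ Module.rank ℚ (DihedralCoalgebra ℚ G w 2) := by
  obtain ⟨d, rfl⟩ := Nat.exists_eq_add_of_le' hw
  refine LinearMap.rank_le_of_surjective ((dihedralRelations G (d + 2) 2).liftQ
    (depthTwoToZeta G d) (dihedralRelations_le_ker_depthTwoToZeta G d)) ?_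
  rw [← LinearMap.range_eq_top, Submodule.range_liftQ, depthTwoToZeta,
    Finsupp.range_linearCombination, ← span_regDoubleZetaClass]
  congr 1
  ext x
  constructor
  · rintro ⟨n, rfl⟩
    exact ⟨_, rfl⟩
  · rintro ⟨i, rfl⟩
    exact ⟨(1, depthTwoIndex d i), by simp⟩

end ReducedZeta

theorem mainTheorem2 (w : ℕ) (hw : 2 ≤ w) :
    (Odd w →
      Module.rank ℚ (ReducedZeta w 2) = 0 ∧
      Module.rank ℚ (DihedralCoalgebra ℚ (rootsOfUnity 1 ℂ) w 2) = 0) ∧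
    (Even w →
      Module.rank ℚ (ReducedZeta w 2) ≤
        Module.rank ℚ (DihedralCoalgebra ℚ (rootsOfUnity 1 ℂ) w 2) ∧
      Module.rank ℚ (DihedralCoalgebra ℚ (rootsOfUnity 1 ℂ) w 2) = ((w - 2) / 6 : ℕ)) := by
  have hle := rank_reducedZeta_le (rootsOfUnity 1 ℂ) hw
  refine ⟨fun h => ?_, fun h => ⟨hle, rank_dihedralCoalgebra_of_even _ hw h⟩⟩
  have h0 := rank_dihedralCoalgebra_of_odd (rootsOfUnity 1 ℂ) hw h
  exact ⟨le_antisymm (h0 ▸ hle) zero_le, h0⟩
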